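/- Let $H$ be a finite graph. A (weighted) $H$-partite graph is a graph $G$ with a partition $V(G)=\bigsqcup_{x\in V(H)}V_x$ and a weight function $w:V(G)\to[0,1]$ such that $\sum_{v\in V_x}w(v)=1$ for every $x\in V(H)$ and every edge of $G$ joins $V_x$ to $V_y$ for some $xy\in E(H)$. For $xy\in E(H)$ put $\alpha_{xy}(G)=\sum_{u\in V_x,\,v\in V_y}w(u)w(v)\mathbb 1_{uv\in E(G)}$, and let $d_H(G)=\min_{xy\in E(H)}\alpha_{xy}(G)$. A transversal of $G$ is a subgraph of $G$ induced by a set of vertices meeting each part $V_x$ in exactly one vertex. For a family $\mathcal F$ of graphs, let $$\pi_H(\mathcal F)=\sup\{d_H(G): G \text{ is an } H\text{-partite graph none of whose transversals contains a copy of a member of } \mathcal F\}.$$ Let $\mathcal T_r$ be the family of all trees on $r$ vertices, let $P_m$ be the path on $m$ vertices, and let $K_2\times P_m$ be the Cartesian product of an edge with $P_m$ (the ladder on $2m$ vertices). **Proposition 1.8.** Let $r\ge 2$ be an integer and let $H$ be a graph on $r$ vertices. 1. If $H$ contains a Hamiltonian path $P_r$, then $\pi_H(\mathcal T_r)<\frac34$.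 2. If $r$ is even and $H$ contains a spanning ladder $K_2\times P_{r/2}$, then $\pi_H(\mathcal T_r)<\frac23$. -/

import Mathlib

open SimpleGraph

/-- A weighted `H`-partite graph. Its vertex set is the disjoint union `Σ x, Part x` of the parts
of the canonical partition, the weights of each part sum to `1`, and every edge joins two parts
indexed by adjacent vertices of `H`. Parts may be finite or infinite. -/
structure HPartiteGraph {X : Type*} (H : SimpleGraph X) where
  Part : X → Type
  graph : SimpleGraph (Σ x, Part x)
  weight : (x : X) → Part x → ℝ
  weight_mem : ∀ x u, weight x u ∈ Set.Icc (0 : ℝ) 1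
  weight_sum : ∀ x, HasSum (weight x) 1
  adj_host : ∀ ⦃a b : Σ x, Part x⦄, graph.Adj a b → H.Adj a.1 b.1

namespace HPartiteGraph

variable {X : Type*} {H : SimpleGraph X}

open scoped Classical in
/-- The density `α_{xy} = ∑_{u ∈ V_x, v ∈ V_y} w(u) w(v) 1_{uv ∈ E(G)}`. -/
noncomputable def pairDensity (G : HPartiteGraph H) (x y : X) : ℝ :=
  ∑' p : G.Part x × G.Part y,
    G.weight x p.1 * G.weight y p.2 * (if G.graph.Adj ⟨x, p.1⟩ ⟨y, p.2⟩ then 1 else 0)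

/-- The `H`-partite density `d_H(G) = min {α_{xy} : xy ∈ E(H)}` (for a finite host graph `H` with
at least one edge the infimum is a minimum). -/
noncomputable def density (G : HPartiteGraph H) : ℝ :=
  sInf {a : ℝ | ∃ x y : X, H.Adj x y ∧ a = G.pairDensity x y}

/-- The transversal that picks the vertex `t x` from each part `Part x`: the subgraph of `G`
induced by the picked vertices, viewed as a spanning subgraph of `H` by naming each picked vertex
after its part. -/
def transversal (G : HPartiteGraph H) (t : (x : X) → G.Part x) : SimpleGraph X :=
  G.graph.comap fun x => ⟨x, t x⟩

/-- Every transversal of `G` is `𝓕`-free, for a family `𝓕` of finite graphs (each represented on a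
vertex set `Fin n`): it contains no copy of a member of `𝓕`. -/
def HasFreeTransversals (G : HPartiteGraph H) (𝓕 : Set (Σ n : ℕ, SimpleGraph (Fin n))) : Prop :=
  ∀ t : (x : X) → G.Part x, ∀ F ∈ 𝓕, F.2.Free (G.transversal t)

end HPartiteGraph

/-- The threshold `π_H(𝓕)`: the supremum of the densities `d_H(G)` over all `H`-partite graphs `G`
with `𝓕`-free transversals. -/
noncomputable def partiteThreshold {X : Type*} (H : SimpleGraph X)
    (𝓕 : Set (Σ n : ℕ, SimpleGraph (Fin n))) : ℝ :=
  sSup {d : ℝ | ∃ G : HPartiteGraph H, G.HasFreeTransversals 𝓕 ∧ d = G.density}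

/-- The family `𝒯_r` of all trees on `r` vertices. -/
def treeFamily (r : ℕ) : Set (Σ n : ℕ, SimpleGraph (Fin n)) :=
  {F | F.1 = r ∧ F.2.IsTree}

/-- The ladder `K_2 × P_m` on `2 * m` vertices. -/
def ladderGraph (m : ℕ) : SimpleGraph (Fin 2 × Fin m) :=
  completeGraph (Fin 2) □ pathGraph m

/-! A transversal with no tree on `r` vertices is disconnected, so it suffices to grow a connected
transversal part by part whenever all densities exceed `1 - γ`. Along a path, let `a` be the mass of
the last vertices of transversal paths. Vertices of the next part that extend none have mass below
`γ / a`, so the next mass is at least `1 - γ / a`. Along a ladder, let `c` bound from below the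
product of the masses of the ends of good last rungs. An edge of the next rung is bad only if
neither end sees the previous good set on its side; such edges have density at most `γ ^ 2 / c`. At
`γ = 1/4` and `γ = 1/3` these recursions stay positive forever. Since only finitely many steps are
needed, a slightly larger `γ` still works, which makes the bounds strict. -/

/-- A summable family of nonnegative weights with total mass one. -/
def IsWeighting {α : Type*} (f : α → ℝ) : Prop :=
  (∀ u, 0 ≤ f u) ∧ HasSum f 1

/-! ### Masses of sets and rectangle bounds -/

namespace IsWeighting

variable {α β : Type*} {f : α → ℝ} {g : β → ℝ}

/-- The total weight of a set. -/
noncomputable def mass (f : α → ℝ) (A : Set α) : ℝ :=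
  ∑' u, A.indicator f u

theorem hasSum_mass (hf : IsWeighting f) (A : Set α) : HasSum (A.indicator f) (mass f A) :=
  (hf.2.summable.indicator A).hasSum

theorem mass_nonneg (hf : IsWeighting f) (A : Set α) : 0 ≤ mass f A :=
  tsum_nonneg fun _ => Set.indicator_nonneg (fun u _ => hf.1 u) _

theorem mass_univ (hf : IsWeighting f) : mass f Set.univ = 1 := by
  simp [mass, hf.2.tsum_eq]

theorem mass_empty (f : α → ℝ) : mass f ∅ = 0 := by
  simp [mass]

theorem mass_compl (hf : IsWeighting f) (A : Set α) : mass f Aᶜ = 1 - mass f A := by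
  have h := (hf.hasSum_mass A).add (hf.hasSum_mass Aᶜ)
  rw [← Pi.add_def, Set.indicator_self_add_compl] at h
  linarith [h.unique hf.2]

theorem nonempty_of_mass_pos {A : Set α} (h : 0 < mass f A) : A.Nonempty := by
  rcases A.eq_empty_or_nonempty with rfl | hA
  · simp [mass_empty] at h
  · exact hA

theorem hasSum_prod (hf : IsWeighting f) (hg : IsWeighting g) (A : Set α) (B : Set β) :
    HasSum (fun p : α × β => A.indicator f p.1 * B.indicator g p.2) (mass f A * mass g B) :=
  (hf.hasSum_mass A).mul (hg.hasSum_mass B)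
    ((hf.hasSum_mass A).summable.mul_of_nonneg (hg.hasSum_mass B).summable
      (fun _ => Set.indicator_nonneg (fun u _ => hf.1 u) _)
      (fun _ => Set.indicator_nonneg (fun u _ => hg.1 u) _))

open scoped Classical in
/-- If all edges of a bipartite graph lie in `A × B` or in `P × Q`, then its density is at most
the sum of the masses of these two rectangles. -/
theorem tsum_le_mass_mul_add (hf : IsWeighting f) (hg : IsWeighting g) {E : α → β → Prop}
    {A P : Set α} {B Q : Set β}
    (h : ∀ u v, E u v → (u ∈ A ∧ v ∈ B) ∨ (u ∈ P ∧ v ∈ Q)) :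
    ∑' p : α × β, f p.1 * g p.2 * (if E p.1 p.2 then 1 else 0) ≤
      mass f A * mass g B + mass f P * mass g Q := by
  have hs := (hf.hasSum_prod hg A B).add (hf.hasSum_prod hg P Q)
  have h0 : ∀ (A : Set α) (B : Set β) (p : α × β),
      0 ≤ A.indicator f p.1 * B.indicator g p.2 := fun A B p =>
    mul_nonneg (Set.indicator_nonneg (fun u _ => hf.1 u) _)
      (Set.indicator_nonneg (fun u _ => hg.1 u) _)
  have hle : ∀ p : α × β, f p.1 * g p.2 * (if E p.1 p.2 then 1 else 0) ≤
      A.indicator f p.1 * B.indicator g p.2 + P.indicator f p.1 * Q.indicator g p.2 := by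
    intro p
    split_ifs with hE
    · rcases h _ _ hE with ⟨h1, h2⟩ | ⟨h1, h2⟩
      · have := h0 P Q p
        simp only [Set.indicator_of_mem h1, Set.indicator_of_mem h2]
        linarith
      · have := h0 A B p
        simp only [Set.indicator_of_mem h1, Set.indicator_of_mem h2]
        linarith
    · rw [mul_zero]
      exact add_nonneg (h0 A B p) (h0 P Q p)
  have hnn : ∀ p : α × β, 0 ≤ f p.1 * g p.2 * (if E p.1 p.2 then 1 else 0) := fun p =>
    mul_nonneg (mul_nonneg (hf.1 _) (hg.1 _)) (by split_ifs <;> norm_num)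
  exact hasSum_le hle (hs.summable.of_nonneg_of_le hnn hle).hasSum hs

end IsWeighting

/-! ### Growing transversals part by part -/

namespace HPartiteGraph

open IsWeighting

variable {X : Type*} {H : SimpleGraph X}

theorem isWeighting (G : HPartiteGraph H) (x : X) : IsWeighting (G.weight x) :=
  ⟨fun u => (G.weight_mem x u).1, G.weight_sum x⟩

theorem pairDensity_le (G : HPartiteGraph H) {x y : X} {A P : Set (G.Part x)}
    {B Q : Set (G.Part y)}
    (h : ∀ u v, G.graph.Adj ⟨x, u⟩ ⟨y, v⟩ → (u ∈ A ∧ v ∈ B) ∨ (u ∈ P ∧ v ∈ Q)) :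
    G.pairDensity x y ≤ mass (G.weight x) A * mass (G.weight y) B +
      mass (G.weight x) P * mass (G.weight y) Q :=
  tsum_le_mass_mul_add (G.isWeighting x) (G.isWeighting y) h

theorem pairDensity_nonneg (G : HPartiteGraph H) (x y : X) : 0 ≤ G.pairDensity x y :=
  tsum_nonneg fun p => mul_nonneg
    (mul_nonneg ((G.isWeighting x).1 p.1) ((G.isWeighting y).1 p.2)) (by split_ifs <;> norm_num)

theorem density_le_pairDensity (G : HPartiteGraph H) {x y : X} (h : H.Adj x y) :
    G.density ≤ G.pairDensity x y := by
  refine csInf_le ⟨0, ?_⟩ ⟨x, y, h, rfl⟩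
  rintro _ ⟨x, y, -, rfl⟩
  exact G.pairDensity_nonneg x y

theorem exists_transversal (G : HPartiteGraph H) : Nonempty ((x : X) → G.Part x) := by
  refine ⟨fun x => (nonempty_of_mass_pos (f := G.weight x) (A := Set.univ) ?_).some⟩
  rw [(G.isWeighting x).mass_univ]
  exact one_pos

/-- In a pair of density more than `1 - γ`, the vertices with no neighbour in `A` have mass less
than `γ / mass A`. -/
theorem mass_compl_lt_div (G : HPartiteGraph H) {x y : X} {γ : ℝ}
    (hd : 1 - γ < G.pairDensity x y) {A : Set (G.Part x)} (hA : 0 < mass (G.weight x) A)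
    {R : Set (G.Part y)} (hR : ∀ u ∈ A, ∀ v, G.graph.Adj ⟨x, u⟩ ⟨y, v⟩ → v ∈ R) :
    mass (G.weight y) Rᶜ < γ / mass (G.weight x) A := by
  have h := G.pairDensity_le (x := x) (y := y) (A := A) (B := R) (P := Aᶜ) (Q := Set.univ)
    fun u v huv => by
      by_cases hu : u ∈ A
      · exact .inl ⟨hu, hR u hu v huv⟩
      · exact .inr ⟨hu, trivial⟩
  rw [(G.isWeighting y).mass_univ, (G.isWeighting x).mass_compl] at h
  rw [lt_div_iff₀ hA, (G.isWeighting y).mass_compl]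
  linarith

theorem transversal_adj_congr (G : HPartiteGraph H) {t t' : (x : X) → G.Part x} {a b : X}
    (ha : t' a = t a) (hb : t' b = t b) :
    (G.transversal t').Adj a b ↔ (G.transversal t).Adj a b := by
  simp only [transversal, SimpleGraph.comap_adj, ha, hb]

/-- If consecutive parts along a path have density more than `1 - γ` and the sequence
`1, 1 - γ, …` defined by `a ↦ 1 - γ / a` stays positive, then some transversal contains the
path. -/
theorem exists_path_transversal (G : HPartiteGraph H) {x : ℕ → X} {n : ℕ}
    (hx : Set.InjOn x (Set.Iic n)) {γ : ℝ} (hγ : 0 ≤ γ) {a : ℕ → ℝ} (ha0 : a 0 = 1)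
    (ha : ∀ k, a (k + 1) = 1 - γ / a k) (hpos : ∀ k ≤ n, 0 < a k)
    (hd : ∀ k < n, 1 - γ < G.pairDensity (x k) (x (k + 1))) :
    ∃ t, ∀ k < n, (G.transversal t).Adj (x k) (x (k + 1)) := by
  classical
  let A : (k : ℕ) → Set (G.Part (x k)) := fun k =>
    {u | ∃ t, (∀ j < k, (G.transversal t).Adj (x j) (x (j + 1))) ∧ t (x k) = u}
  have key : ∀ k ≤ n, a k ≤ mass (G.weight (x k)) (A k) := by
    intro k
    induction k with
    | zero =>
      intro _
      have hA : A 0 = Set.univ := by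
        obtain ⟨t⟩ := G.exists_transversal
        refine Set.eq_univ_of_forall fun u => ⟨Function.update t (x 0) u, by simp, by simp⟩
      rw [hA, (G.isWeighting _).mass_univ, ha0]
    | succ k ih =>
      intro hk
      have hak := hpos k (by omega)
      have hA := ih (by omega)
      have h := G.mass_compl_lt_div (hd k hk) (hak.trans_le hA) (R := A (k + 1)) (by
        -- Part `x (k + 1)` is not among the earlier ones, so resetting the choice there keeps the
        -- path.
        rintro u ⟨t, ht, rfl⟩ v huv
        have hne : ∀ j ≤ k, x j ≠ x (k + 1) := fun j hj h => by
          have := hx (show j ≤ n by omega) hk h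
          omega
        refine ⟨Function.update t (x (k + 1)) v, fun j hj => ?_, by simp⟩
        rcases Nat.lt_succ_iff_lt_or_eq.1 hj with hj | rfl
        · refine (G.transversal_adj_congr ?_ ?_).2 (ht j hj)
          · exact Function.update_of_ne (hne j hj.le) ..
          · exact Function.update_of_ne (hne (j + 1) hj) ..
        · simpa [transversal, Function.update_of_ne (hne j le_rfl)] using huv)
      rw [(G.isWeighting _).mass_compl] at h
      have := div_le_div_of_nonneg_left hγ hak hA
      rw [ha]
      linarith
  obtain ⟨u, t, ht, -⟩ := nonempty_of_mass_pos ((hpos n le_rfl).trans_le (key n le_rfl))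
  exact ⟨t, ht⟩

/-- If the pairs of parts along the edges of a ladder have density more than `1 - γ` and the
sequence starting with `1 - γ` and defined by `c ↦ 1 - γ - γ ^ 2 / c` stays positive, then some
transversal contains every rung and, between any two consecutive rungs, at least one edge. -/
theorem exists_ladder_transversal (G : HPartiteGraph H) {x y : ℕ → X} {n : ℕ}
    (hx : Set.InjOn x (Set.Iic n)) (hy : Set.InjOn y (Set.Iic n))
    (hxy : ∀ i ≤ n, ∀ j ≤ n, x i ≠ y j) {γ : ℝ} {c : ℕ → ℝ}
    (hc0 : c 0 = 1 - γ) (hc : ∀ k, c (k + 1) = 1 - γ - γ ^ 2 / c k) (hpos : ∀ k ≤ n, 0 < c k)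
    (hd : ∀ k ≤ n, 1 - γ < G.pairDensity (x k) (y k))
    (hdx : ∀ k < n, 1 - γ < G.pairDensity (x k) (x (k + 1)))
    (hdy : ∀ k < n, 1 - γ < G.pairDensity (y k) (y (k + 1))) :
    ∃ t, (∀ k ≤ n, (G.transversal t).Adj (x k) (y k)) ∧
      ∀ k < n, (G.transversal t).Adj (x k) (x (k + 1)) ∨
        (G.transversal t).Adj (y k) (y (k + 1)) := by
  classical
  let good : ℕ → ((z : X) → G.Part z) → Prop := fun k t =>
    (∀ j ≤ k, (G.transversal t).Adj (x j) (y j)) ∧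
      ∀ j < k, (G.transversal t).Adj (x j) (x (j + 1)) ∨
        (G.transversal t).Adj (y j) (y (j + 1))
  let A : (k : ℕ) → Set (G.Part (x k)) := fun k => {u | ∃ t, good k t ∧ t (x k) = u}
  let B : (k : ℕ) → Set (G.Part (y k)) := fun k => {u | ∃ t, good k t ∧ t (y k) = u}
  have hext : ∀ k ≤ n, ∀ (t : (z : X) → G.Part z) (u : G.Part (x k)) (v : G.Part (y k)),
      ∃ t' : (z : X) → G.Part z, t' (x k) = u ∧ t' (y k) = v ∧
        ∀ j < k, t' (x j) = t (x j) ∧ t' (y j) = t (y j) := by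
    intro k hk t u v
    refine ⟨Function.update (Function.update t (x k) u) (y k) v, ?_, by simp, ?_⟩
    · rw [Function.update_of_ne (hxy k hk k hk), Function.update_self]
    · intro j hj
      have h1 : x j ≠ x k := fun h => by
        have := hx (show j ≤ n by omega) hk h
        omega
      have h2 : y j ≠ y k := fun h => by
        have := hy (show j ≤ n by omega) hk h
        omega
      rw [Function.update_of_ne (hxy j (by omega) k hk), Function.update_of_ne h1,
        Function.update_of_ne h2, Function.update_of_ne (hxy k hk j (by omega)).symm]
      exact ⟨rfl, rfl⟩
  have key : ∀ k ≤ n, c k ≤ mass (G.weight (x k)) (A k) * mass (G.weight (y k)) (B k) := by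
    intro k
    induction k with
    | zero =>
      intro h0
      have h := G.pairDensity_le (x := x 0) (y := y 0) (A := A 0) (B := B 0) (P := ∅) (Q := ∅)
        fun u v huv => by
          obtain ⟨t⟩ := G.exists_transversal
          obtain ⟨t', hu, hv, -⟩ := hext 0 h0 t u v
          have hg : good 0 t' := by
            refine ⟨fun j hj => ?_, fun j hj => by omega⟩
            obtain rfl : j = 0 := by omega
            simpa only [transversal, SimpleGraph.comap_adj, hu, hv] using huv
          exact .inl ⟨⟨t', hg, hu⟩, ⟨t', hg, hv⟩⟩
      rw [mass_empty, zero_mul, add_zero] at h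
      linarith [hd 0 h0]
    | succ k ih =>
      intro hk
      have hck := hpos k (by omega)
      have hAB := ih (by omega)
      have hA0 := (G.isWeighting _).mass_nonneg (A k)
      have hB0 := (G.isWeighting _).mass_nonneg (B k)
      have hA : 0 < mass (G.weight (x k)) (A k) :=
        pos_of_mul_pos_left (hck.trans_le hAB) hB0
      have hB : 0 < mass (G.weight (y k)) (B k) :=
        pos_of_mul_pos_right (hck.trans_le hAB) hA0
      let R : Set (G.Part (x (k + 1))) := {v | ∃ u ∈ A k, G.graph.Adj ⟨x k, u⟩ ⟨x (k + 1), v⟩}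
      let S : Set (G.Part (y (k + 1))) := {v | ∃ u ∈ B k, G.graph.Adj ⟨y k, u⟩ ⟨y (k + 1), v⟩}
      have hR := G.mass_compl_lt_div (hdx k hk) hA (R := R) fun u hu v huv => ⟨u, hu, huv⟩
      have hS := G.mass_compl_lt_div (hdy k hk) hB (R := S) fun u hu v huv => ⟨u, hu, huv⟩
      have hgood : ∀ t t' : (z : X) → G.Part z, good k t →
          (∀ j < k + 1, t' (x j) = t (x j) ∧ t' (y j) = t (y j)) →
          (G.transversal t').Adj (x (k + 1)) (y (k + 1)) →
          ((G.transversal t').Adj (x k) (x (k + 1)) ∨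
            (G.transversal t').Adj (y k) (y (k + 1))) → good (k + 1) t' := by
        intro t t' ht hag hr he
        constructor
        · intro j hj
          rcases Nat.le_succ_iff.1 hj with hj | rfl
          · have := hag j (by omega)
            exact (G.transversal_adj_congr this.1 this.2).2 (ht.1 j hj)
          · exact hr
        · intro j hj
          rcases Nat.lt_succ_iff_lt_or_eq.1 hj with hj | rfl
          · have h1 := hag j (by omega)
            have h2 := hag (j + 1) (by omega)
            rw [G.transversal_adj_congr h1.1 h2.1, G.transversal_adj_congr h1.2 h2.2]
            exact ht.2 j hj
          · exact he
      -- One good neighbour on either side suffices to extend, and then both ends of the rung are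
      -- good. The remaining edges lie in the rectangle `Rᶜ × Sᶜ`.
      have h := G.pairDensity_le (x := x (k + 1)) (y := y (k + 1)) (A := A (k + 1))
        (B := B (k + 1)) (P := Rᶜ) (Q := Sᶜ) fun u v huv => by
          by_cases hu : u ∈ R
          · obtain ⟨_, ⟨t, ht, rfl⟩, hadj⟩ := hu
            obtain ⟨t', hu, hv, hag⟩ := hext (k + 1) hk t u v
            have hg : good (k + 1) t' := hgood t t' ht hag
              (by simpa only [transversal, SimpleGraph.comap_adj, hu, hv] using huv)
              (.inl (by
                simpa only [transversal, SimpleGraph.comap_adj, hu,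
                  (hag k (by omega)).1] using hadj))
            exact .inl ⟨⟨t', hg, hu⟩, ⟨t', hg, hv⟩⟩
          by_cases hv : v ∈ S
          · obtain ⟨_, ⟨t, ht, rfl⟩, hadj⟩ := hv
            obtain ⟨t', hu, hv, hag⟩ := hext (k + 1) hk t u v
            have hg : good (k + 1) t' := hgood t t' ht hag
              (by simpa only [transversal, SimpleGraph.comap_adj, hu, hv] using huv)
              (.inr (by
                simpa only [transversal, SimpleGraph.comap_adj, hv,
                  (hag k (by omega)).2] using hadj))
            exact .inl ⟨⟨t', hg, hu⟩, ⟨t', hg, hv⟩⟩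
          · exact .inr ⟨hu, hv⟩
      have hRS := mul_le_mul hR.le hS.le ((G.isWeighting _).mass_nonneg Sᶜ)
        (((G.isWeighting _).mass_nonneg Rᶜ).trans hR.le)
      rw [div_mul_div_comm, ← sq] at hRS
      have := div_le_div_of_nonneg_left (sq_nonneg γ) hck hAB
      rw [hc]
      linarith [hd (k + 1) hk]
  obtain ⟨u, t, ht, -⟩ := nonempty_of_mass_pos (pos_of_mul_pos_left
    ((hpos n le_rfl).trans_le (key n le_rfl)) ((G.isWeighting _).mass_nonneg (B n)))
  exact ⟨t, ht⟩

/-- A spanning tree of a connected transversal is a forbidden tree. -/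
theorem HasFreeTransversals.not_connected [Fintype X] {G : HPartiteGraph H}
    (hG : G.HasFreeTransversals (treeFamily (Fintype.card X))) (t : (x : X) → G.Part x) :
    ¬ (G.transversal t).Connected := by
  intro hc
  obtain ⟨T, hT, htree⟩ := hc.exists_isTree_le
  let e := Fintype.equivFin X
  refine hG t ⟨Fintype.card X, T.map e.toEmbedding⟩ ⟨rfl, ?_⟩ ?_
  · exact (SimpleGraph.Iso.map e T).isTree_iff.1 htree
  · exact (SimpleGraph.Iso.map e T).symm.isContained.trans (.of_le hT)

end HPartiteGraph

/-! ### Parameters beyond the critical value -/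

open Filter Topology in
/-- A recursion `a ↦ φ γ - ψ γ / a` which at the parameter `γ₀` produces a positive sequence
produces, for some parameter in any interval `(γ₀, δ)`, a sequence positive up to any given
index. -/
theorem exists_gt_forall_pos {γ₀ δ : ℝ} (hδ : γ₀ < δ) {a : ℝ → ℕ → ℝ} {φ ψ : ℝ → ℝ}
    (hφ : Continuous φ) (hψ : Continuous ψ) (h0 : ContinuousAt (a · 0) γ₀)
    (ha : ∀ γ k, a γ (k + 1) = φ γ - ψ γ / a γ k) (hpos : ∀ k, 0 < a γ₀ k) (n : ℕ) :
    ∃ γ, γ₀ < γ ∧ γ < δ ∧ ∀ k ≤ n, 0 < a γ k := by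
  have hcont : ∀ k, ContinuousAt (a · k) γ₀ := by
    intro k
    induction k with
    | zero => exact h0
    | succ k ih =>
      simp only [ha]
      exact hφ.continuousAt.sub (hψ.continuousAt.div ih (hpos k).ne')
  have hev : ∀ᶠ γ in 𝓝 γ₀, ∀ k ∈ Set.Iic n, 0 < a γ k :=
    (Filter.eventually_all_finite (Set.finite_Iic n)).2 fun k _ =>
      (hcont k).eventually_const_lt (hpos k)
  obtain ⟨γ, hγ, h1, h2⟩ := ((hev.filter_mono nhdsWithin_le_nhds).and
    (Ioo_mem_nhdsGT hδ)).exists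
  exact ⟨γ, h1, h2, hγ⟩

/-- At `1/4` the recursion has the double fixed point `1/2`, and its orbit from `1` decreases to it.
-/
theorem exists_path_parameter (n : ℕ) : ∃ (γ : ℝ) (a : ℕ → ℝ), 1 / 4 < γ ∧ γ < 1 ∧ a 0 = 1 ∧
    (∀ k, a (k + 1) = 1 - γ / a k) ∧ ∀ k ≤ n, 0 < a k := by
  let a : ℝ → ℕ → ℝ := fun γ k => Nat.rec 1 (fun _ c => 1 - γ / c) k
  have hval : ∀ k : ℕ, a (1 / 4) k = (k + 2) / (2 * (k + 1)) := by
    intro k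
    induction k with
    | zero => simp [a]
    | succ k ih =>
      change 1 - 1 / 4 / a (1 / 4) k = _
      rw [ih]
      push_cast
      field_simp
      ring
  obtain ⟨γ, h1, h2, h3⟩ := exists_gt_forall_pos (γ₀ := 1 / 4) (δ := 1) (by norm_num) (a := a)
    (φ := fun _ => 1) (ψ := fun γ => γ) continuous_const continuous_id continuousAt_const
    (fun _ _ => rfl) (fun k => by rw [hval]; positivity) n
  exact ⟨γ, a γ, h1, h2, rfl, fun _ => rfl, h3⟩

/-- At `1/3` the double fixed point is `1/3`, approached from `2/3`. -/
theorem exists_ladder_parameter (n : ℕ) : ∃ (γ : ℝ) (c : ℕ → ℝ), 1 / 3 < γ ∧ γ < 1 ∧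
    c 0 = 1 - γ ∧ (∀ k, c (k + 1) = 1 - γ - γ ^ 2 / c k) ∧ ∀ k ≤ n, 0 < c k := by
  let a : ℝ → ℕ → ℝ := fun γ k => Nat.rec (1 - γ) (fun _ c => 1 - γ - γ ^ 2 / c) k
  have hval : ∀ k : ℕ, a (1 / 3) k = (k + 2) / (3 * (k + 1)) := by
    intro k
    induction k with
    | zero => norm_num [a]
    | succ k ih =>
      change 1 - 1 / 3 - (1 / 3) ^ 2 / a (1 / 3) k = _
      rw [ih]
      push_cast
      field_simp
      ring
  obtain ⟨γ, h1, h2, h3⟩ := exists_gt_forall_pos (γ₀ := 1 / 3) (δ := 1) (by norm_num) (a := a)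
    (φ := fun γ => 1 - γ) (ψ := fun γ => γ ^ 2) (by fun_prop) (by fun_prop)
    (show ContinuousAt (fun γ : ℝ => 1 - γ) _ by fun_prop)
    (fun _ _ => rfl) (fun k => by rw [hval]; positivity) n
  exact ⟨γ, a γ, h1, h2, rfl, fun _ => rfl, h3⟩

/-! ### Threshold bounds -/

/-- To bound the tree threshold it suffices to find connected transversals. -/
theorem partiteThreshold_treeFamily_le {X : Type*} [Fintype X] {H : SimpleGraph X} {γ : ℝ}
    (hγ : γ < 1)
    (h : ∀ G : HPartiteGraph H, (∀ x y, H.Adj x y → 1 - γ < G.pairDensity x y) →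
      ∃ t, (G.transversal t).Connected) :
    partiteThreshold H (treeFamily (Fintype.card X)) ≤ 1 - γ := by
  -- The bound must be nonnegative because the real `sSup` of the empty set is `0`.
  refine Real.sSup_le ?_ (by linarith)
  rintro _ ⟨G, hG, rfl⟩
  by_contra! hlt
  obtain ⟨t, ht⟩ := h G fun x y hxy => hlt.trans_le (G.density_le_pairDensity hxy)
  exact hG.not_connected t ht

theorem partiteThreshold_treeFamily_lt_of_path {X : Type*} [Fintype X] {H : SimpleGraph X} {n : ℕ}
    (hX : Fintype.card X = n + 1) (hH : pathGraph (n + 1) ⊑ H) :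
    partiteThreshold H (treeFamily (Fintype.card X)) < 3 / 4 := by
  obtain ⟨f⟩ := hH
  obtain ⟨γ, a, hγ, hγ1, ha0, ha, hpos⟩ := exists_path_parameter n
  refine (partiteThreshold_treeFamily_le hγ1 fun G hG => ?_).trans_lt (by linarith)
  -- Indices wrap modulo `n + 1`; only those up to `n` matter.
  let x : ℕ → X := fun i => f (Fin.ofNat (n + 1) i)
  have hval : ∀ i ≤ n, (Fin.ofNat (n + 1) i : ℕ) = i := fun i hi =>
    Nat.mod_eq_of_lt (by omega)
  have hinj : Set.InjOn x (Set.Iic n) := by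
    intro i hi j hj hij
    have := congrArg Fin.val (f.injective hij)
    rwa [hval i hi, hval j hj] at this
  have hsurj : ∀ z, ∃ i ≤ n, x i = z := by
    have hbij : Function.Bijective f :=
      (Fintype.bijective_iff_injective_and_card f).2 ⟨f.injective, by simp [hX]⟩
    intro z
    obtain ⟨i, rfl⟩ := hbij.2 z
    refine ⟨i, by omega, congrArg f (Fin.ext (hval i (by omega)))⟩
  have hadj : ∀ k < n, H.Adj (x k) (x (k + 1)) := fun k hk => by
    refine f.toHom.map_adj ?_
    rw [pathGraph_adj, hval k hk.le, hval (k + 1) hk]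
    exact .inl rfl
  obtain ⟨t, ht⟩ := G.exists_path_transversal hinj (by linarith) ha0 ha hpos
    fun k hk => hG _ _ (hadj k hk)
  have hreach : ∀ k ≤ n, (G.transversal t).Reachable (x 0) (x k) := by
    intro k
    induction k with
    | zero => exact fun _ => .refl _
    | succ k ih => exact fun hk => (ih (by omega)).trans (ht k hk).reachable
  refine ⟨t, (connected_iff_exists_forall_reachable _).2 ⟨x 0, fun z => ?_⟩⟩
  obtain ⟨i, hi, rfl⟩ := hsurj z
  exact hreach i hi

theorem partiteThreshold_treeFamily_lt_of_ladder {X : Type*} [Fintype X] {H : SimpleGraph X}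
    {n : ℕ} (hX : Fintype.card X = 2 * (n + 1)) (hH : ladderGraph (n + 1) ⊑ H) :
    partiteThreshold H (treeFamily (Fintype.card X)) < 2 / 3 := by
  obtain ⟨f⟩ := hH
  obtain ⟨γ, c, hγ, hγ1, hc0, hc, hpos⟩ := exists_ladder_parameter n
  refine (partiteThreshold_treeFamily_le hγ1 fun G hG => ?_).trans_lt (by linarith)
  let x : Fin 2 → ℕ → X := fun s i => f (s, Fin.ofNat (n + 1) i)
  have hval : ∀ i ≤ n, (Fin.ofNat (n + 1) i : ℕ) = i := fun i hi =>
    Nat.mod_eq_of_lt (by omega)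
  have hinj : ∀ s, Set.InjOn (x s) (Set.Iic n) := by
    intro s i hi j hj hij
    have := congrArg (fun p => (p.2 : ℕ)) (f.injective hij)
    simpa only [hval i hi, hval j hj] using this
  have hne : ∀ i ≤ n, ∀ j ≤ n, x 0 i ≠ x 1 j := fun i _ j _ hij => by
    simpa using congrArg Prod.fst (f.injective hij)
  have hsurj : ∀ z, ∃ s, ∃ i ≤ n, x s i = z := by
    have hbij : Function.Bijective f :=
      (Fintype.bijective_iff_injective_and_card f).2 ⟨f.injective, by simp [hX]⟩
    intro z
    obtain ⟨⟨s, i⟩, rfl⟩ := hbij.2 z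
    exact ⟨s, i, by omega, congrArg f (Prod.ext rfl (Fin.ext (hval i (by omega))))⟩
  have hrung : ∀ k, H.Adj (x 0 k) (x 1 k) := fun k => by
    refine f.toHom.map_adj ?_
    simp [ladderGraph, boxProd_adj]
  have hadj : ∀ s, ∀ k < n, H.Adj (x s k) (x s (k + 1)) := fun s k hk => by
    refine f.toHom.map_adj ?_
    rw [ladderGraph, boxProd_adj, pathGraph_adj, hval k hk.le, hval (k + 1) hk]
    exact .inr ⟨.inl rfl, rfl⟩
  obtain ⟨t, ht, ht'⟩ := G.exists_ladder_transversal (hinj 0) (hinj 1) hne hc0 hc hpos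
    (fun k _ => hG _ _ (hrung k)) (fun k hk => hG _ _ (hadj 0 k hk))
    (fun k hk => hG _ _ (hadj 1 k hk))
  have hreach : ∀ k ≤ n, (G.transversal t).Reachable (x 0 0) (x 0 k) := by
    intro k
    induction k with
    | zero => exact fun _ => .refl _
    | succ k ih =>
      intro hk
      have h := ih (by omega)
      rcases ht' k hk with h' | h'
      · exact h.trans h'.reachable
      -- Cross rung `k`, follow the other rail, and return by rung `k + 1`.
      · exact ((h.trans (ht k (by omega)).reachable).trans h'.reachable).trans
          (ht (k + 1) hk).reachable.symm
  refine ⟨t, (connected_iff_exists_forall_reachable _).2 ⟨x 0 0, fun z => ?_⟩⟩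
  obtain ⟨s, i, hi, rfl⟩ := hsurj z
  fin_cases s
  · exact hreach i hi
  · exact (hreach i hi).trans (ht i hi).reachable

theorem proposition1p8 {X : Type*} [Fintype X] (H : SimpleGraph X) (r : ℕ) (hr : 2 ≤ r)
    (hX : Fintype.card X = r) :
    (pathGraph r ⊑ H → partiteThreshold H (treeFamily r) < 3 / 4) ∧
    (Even r → ladderGraph (r / 2) ⊑ H → partiteThreshold H (treeFamily r) < 2 / 3) := by
  subst hX
  constructor
  · intro h
    obtain ⟨n, hn⟩ : ∃ n, Fintype.card X = n + 1 := ⟨Fintype.card X - 1, by omega⟩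
    exact partiteThreshold_treeFamily_lt_of_path hn (hn ▸ h)
  · rintro ⟨m, hm⟩ h
    obtain ⟨n, hn⟩ : ∃ n, Fintype.card X / 2 = n + 1 := ⟨Fintype.card X / 2 - 1, by omega⟩
    exact partiteThreshold_treeFamily_lt_of_ladder (by omega) (hn ▸ h)
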